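/- Let $\mathbb{C}$ be a regular category, i.e. a category with finite limits in which every kernel pair has a coequalizer and regular epimorphisms are stable under pullback (equivalently, every morphism factors as a regular epimorphism followed by a monomorphism, and these factorizations are stable under pullback). A relation on an object $X$ is a subobject $\langle r_1,r_2\rangle\colon R\rightarrowtail X\times X$; for generalized elements $x,y\colon A\to X$ we write $(x,y)\in R$ when $\langle x,y\rangle\colon A\to X\times X$ factors through $R$. The relation $R$ is reflexive if it contains the diagonal of $X$, and it is an equivalence relation if it is reflexive, symmetric and transitive. Then the following conditions are equivalent: (i) $\mathbb{C}$ is a Mal'tsev category, i.e. every reflexive relation in $\mathbb{C}$ is an equivalence relation; (ii) the Shifting Lemma holds in $\mathbb{C}$ for reflexive relations, i.e. for every object $X$ and all reflexive relations $R,S,T$ on $X$ with $R\wedge S\leqslant T$, and for all generalized elements $x,y,u,v\colon A\to X$ (with $A$ any object of $\mathbb{C}$), if $(x,y)\in R\wedge T$, $(x,u)\in S$, $(y,v)\in S$ and $(u,v)\in R$, then $(u,v)\in T$. -/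

import Mathlib

universe v u

namespace RegularRelations

open CategoryTheory CategoryTheory.Limits

variable {C : Type u} [Category.{v} C] [HasFiniteLimits C]

/-- An internal relation from `X` to `Y`: a subobject of `X ⨯ Y`. -/
abbrev Relation (X Y : C) := Subobject (X ⨯ Y)

/-- The first leg `r₁ : R ⟶ X` of a relation `⟨r₁, r₂⟩ : R ↣ X ⨯ Y`. -/
noncomputable abbrev leg₁ {X Y : C} (R : Relation X Y) : (R : C) ⟶ X := R.arrow ≫ prod.fst

/-- The second leg `r₂ : R ⟶ Y` of a relation `⟨r₁, r₂⟩ : R ↣ X ⨯ Y`. -/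
noncomputable abbrev leg₂ {X Y : C} (R : Relation X Y) : (R : C) ⟶ Y := R.arrow ≫ prod.snd

/-- `(x, y) ∈ R` for generalised elements `x : A ⟶ X` and `y : A ⟶ Y`: the morphism
`⟨x, y⟩ : A ⟶ X ⨯ Y` factors through `R`. -/
def Holds {X Y : C} (R : Relation X Y) {A : C} (x : A ⟶ X) (y : A ⟶ Y) : Prop :=
  R.Factors (prod.lift x y)

/-- A relation on `X` is reflexive when its legs admit a common section `X ⟶ R`,
that is, when the diagonal of `X` is contained in `R`. -/
def IsReflexive {X : C} (R : Relation X X) : Prop :=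
  Nonempty (ReflexiveRelation (leg₁ R) (leg₂ R))

/-- A relation on `X` is an (internal) equivalence relation when it is reflexive, symmetric and
transitive. -/
def IsEquivalence {X : C} (R : Relation X X) : Prop :=
  IsEquivalenceRelation (leg₁ R) (leg₂ R)

/-- A finitely complete category is a Mal'tsev category if every reflexive relation in it is an
equivalence relation. -/
def IsMaltsevCategory (C : Type u) [Category.{v} C] [HasFiniteLimits C] : Prop :=
  ∀ (X : C) (R : Relation X X), IsReflexive R → IsEquivalence R

/-- The shifting property for three relations `R`, `S`, `T` on `X`: if `R ∧ S ≤ T`, then for all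
generalised elements `x, y, u, v` of `X` with `(x, y) ∈ R ∧ T`, `(x, u) ∈ S`, `(y, v) ∈ S` and
`(u, v) ∈ R`, one has `(u, v) ∈ T`. -/
def ShiftingProperty {X : C} (R S T : Relation X X) : Prop :=
  R ⊓ S ≤ T → ∀ (A : C) (x y u v : A ⟶ X),
    Holds (R ⊓ T) x y → Holds S x u → Holds S y v → Holds R u v → Holds T u v

/-- The Shifting Lemma holds in `C` for all reflexive relations `R`, `S`, `T` on the same
object. -/
def ShiftingLemmaForReflexive (C : Type u) [Category.{v} C] [HasFiniteLimits C] : Prop :=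
  ∀ (X : C) (R S T : Relation X X), IsReflexive R → IsReflexive S → IsReflexive T →
    ShiftingProperty R S T

end RegularRelations

namespace RegularRelations

open CategoryTheory CategoryTheory.Limits

/-! Relations are handled through generalized elements, as in sets. Regularity matters only for (i)
⇒ (ii): there the middle element of a composite exists only after passing to a cover, and the
conclusion descends because strong epimorphisms lift against `P.arrow`. (i) ⇒ (ii): the composite of
`S` and `R ⊓ T` is reflexive, hence symmetric; reversing the path from `u` through `x` to `y` yields
a `w` that completes the argument (`shiftingLemma_of_isMaltsevCategory`). (ii) ⇒ (i): shifting with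
`E°`, `E`, `E` makes every reflexive `E` symmetric, and symmetry of all reflexive relations forces
transitivity (`isMaltsevCategory_of_symm`). -/

theorem factors_of_strongEpi {C : Type u} [Category.{v} C] {X A B : C} {P : Subobject X}
    (q : B ⟶ A) [StrongEpi q] {f : A ⟶ X} (h : P.Factors (q ≫ f)) : P.Factors f := by
  have sq : CommSq (P.factorThru _ h) q P.arrow f := ⟨Subobject.factorThru_arrow ..⟩
  exact (Subobject.factors_iff _ _).2 ⟨sq.lift, sq.fac_right⟩

section FiniteLimits

variable {C : Type u} [Category.{v} C] [HasFiniteLimits C]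

theorem Holds.precomp {X Y : C} {R : Relation X Y} {A B : C} {x : A ⟶ X} {y : A ⟶ Y}
    (h : Holds R x y) (q : B ⟶ A) : Holds R (q ≫ x) (q ≫ y) := by
  simpa only [Holds, ← prod.comp_lift] using Subobject.factors_of_factors_right q h

theorem holds_iff_exists {X Y : C} {R : Relation X Y} {A : C} {x : A ⟶ X} {y : A ⟶ Y} :
    Holds R x y ↔ ∃ f : A ⟶ (R : C), f ≫ leg₁ R = x ∧ f ≫ leg₂ R = y := by
  constructor
  · intro h
    have h : R.Factors (prod.lift x y) := h
    exact ⟨R.factorThru _ h,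
      by rw [← Category.assoc, Subobject.factorThru_arrow, prod.lift_fst],
      by rw [← Category.assoc, Subobject.factorThru_arrow, prod.lift_snd]⟩
  · rintro ⟨f, rfl, rfl⟩
    have e : prod.lift (f ≫ leg₁ R) (f ≫ leg₂ R) = f ≫ R.arrow := by
      apply Limits.prod.hom_ext
      · rw [prod.lift_fst, Category.assoc]
      · rw [prod.lift_snd, Category.assoc]
    simpa only [Holds, e] using Subobject.factors_comp_arrow f

theorem holds_comp_legs {X Y : C} (R : Relation X Y) {A : C} (f : A ⟶ (R : C)) :
    Holds R (f ≫ leg₁ R) (f ≫ leg₂ R) :=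
  holds_iff_exists.2 ⟨f, rfl, rfl⟩

theorem holds_legs {X Y : C} (R : Relation X Y) : Holds R (leg₁ R) (leg₂ R) :=
  holds_iff_exists.2 ⟨𝟙 _, Category.id_comp _, Category.id_comp _⟩

theorem holds_inf {X Y : C} {R S : Relation X Y} {A : C} {x : A ⟶ X} {y : A ⟶ Y} :
    Holds (R ⊓ S) x y ↔ Holds R x y ∧ Holds S x y :=
  Subobject.inf_factors _

theorem Holds.mono {X Y : C} {R S : Relation X Y} (hRS : R ≤ S) {A : C} {x : A ⟶ X} {y : A ⟶ Y}
    (h : Holds R x y) : Holds S x y :=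
  Subobject.factors_of_le _ hRS h

theorem jointlyMono₂_legs {X Y : C} (R : Relation X Y) : JointlyMono₂ (leg₁ R) (leg₂ R) where
  right_cancellation A f g h₁ h₂ := by
    rw [← cancel_mono R.arrow]
    apply Limits.prod.hom_ext
    · simpa only [Category.assoc] using h₁
    · simpa only [Category.assoc] using h₂

theorem isReflexive_iff {X : C} {R : Relation X X} :
    IsReflexive R ↔ ∀ (A : C) (x : A ⟶ X), Holds R x x := by
  constructor
  · rintro ⟨h⟩ A x
    exact holds_iff_exists.2 ⟨x ≫ h.r, by simp only [Category.assoc, h.reflexivity₁,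
      Category.comp_id], by simp only [Category.assoc, h.reflexivity₂, Category.comp_id]⟩
  · intro h
    obtain ⟨r, h₁, h₂⟩ := holds_iff_exists.1 (h X (𝟙 X))
    exact ⟨{ jointlyMono₂_legs R with r := r, reflexivity₁ := h₁, reflexivity₂ := h₂ }⟩

theorem IsEquivalence.symm {X : C} {R : Relation X X} (hR : IsEquivalence R) {A : C}
    {x y : A ⟶ X} (h : Holds R x y) : Holds R y x := by
  obtain ⟨e⟩ := hR.nonempty_equivalenceRelation
  obtain ⟨f, rfl, rfl⟩ := holds_iff_exists.1 h
  exact holds_iff_exists.2 ⟨f ≫ e.s, by simp only [Category.assoc, e.symmetry₁],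
    by simp only [Category.assoc, e.symmetry₂]⟩

theorem IsEquivalence.trans {X : C} {R : Relation X X} (hR : IsEquivalence R) {A : C}
    {x y z : A ⟶ X} (h : Holds R x y) (h' : Holds R y z) : Holds R x z := by
  obtain ⟨e⟩ := hR.nonempty_equivalenceRelation
  obtain ⟨f, rfl, rfl⟩ := holds_iff_exists.1 h
  obtain ⟨g, hg, rfl⟩ := holds_iff_exists.1 h'
  obtain ⟨l, hl₁, hl₂⟩ := PullbackCone.IsLimit.lift' e.isLimit f g hg.symm
  refine holds_iff_exists.2 ⟨l ≫ e.t, ?_, ?_⟩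
  · rw [Category.assoc, e.transitivity₁, ← Category.assoc, hl₁]
  · rw [Category.assoc, e.transitivity₂, ← Category.assoc, hl₂]

theorem isEquivalence_of_holds {X : C} {R : Relation X X}
    (hrefl : ∀ (A : C) (x : A ⟶ X), Holds R x x)
    (hsymm : ∀ (A : C) (x y : A ⟶ X), Holds R x y → Holds R y x)
    (htrans : ∀ (A : C) (x y z : A ⟶ X), Holds R x y → Holds R y z → Holds R x z) :
    IsEquivalence R := by
  -- Each structure morphism comes from the generic instance: the identity of `X`, the legs of `R`,
  -- and the universal composable pair.
  obtain ⟨r, hr₁, hr₂⟩ := holds_iff_exists.1 (hrefl X (𝟙 X))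
  obtain ⟨s, hs₁, hs₂⟩ := holds_iff_exists.1 (hsymm _ _ _ (holds_legs R))
  have hcomp : Holds R (pullback.fst (leg₂ R) (leg₁ R) ≫ leg₁ R)
      (pullback.snd (leg₂ R) (leg₁ R) ≫ leg₂ R) := by
    refine htrans _ _ _ _ (holds_comp_legs R _) ?_
    rw [pullback.condition]
    exact holds_comp_legs R _
  obtain ⟨t, ht₁, ht₂⟩ := holds_iff_exists.1 hcomp
  exact ⟨⟨{ jointlyMono₂_legs R with
    r := r
    reflexivity₁ := hr₁
    reflexivity₂ := hr₂
    s := s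
    symmetry₁ := hs₁
    symmetry₂ := hs₂
    c := pullback.cone (leg₂ R) (leg₁ R)
    isLimit := pullback.isLimit _ _
    t := t
    transitivity₁ := ht₁
    transitivity₂ := ht₂ }⟩⟩

/-- The opposite `R° : Y ⇸ X` of a relation `R : X ⇸ Y`. -/
noncomputable def opposite {X Y : C} (R : Relation X Y) : Relation Y X :=
  (Subobject.pullback (prod.lift prod.snd prod.fst)).obj R

theorem holds_opposite {X Y : C} {R : Relation X Y} {A : C} {y : A ⟶ Y} {x : A ⟶ X} :
    Holds (opposite R) y x ↔ Holds R x y := by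
  rw [Holds, opposite, Limits.pullback_factors_iff, prod.comp_lift, prod.lift_fst,
    prod.lift_snd, Holds]

/-- The inverse image of a relation along a pair of morphisms. -/
noncomputable def inverseImage {X Y X' Y' : C} (f : X' ⟶ X) (g : Y' ⟶ Y) (R : Relation X Y) :
    Relation X' Y' :=
  (Subobject.pullback (prod.map f g)).obj R

theorem holds_inverseImage {X Y X' Y' : C} {f : X' ⟶ X} {g : Y' ⟶ Y} {R : Relation X Y} {A : C}
    {x : A ⟶ X'} {y : A ⟶ Y'} :
    Holds (inverseImage f g R) x y ↔ Holds R (x ≫ f) (y ≫ g) := by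
  rw [Holds, inverseImage, Limits.pullback_factors_iff, prod.lift_map, Holds]

/-- If every reflexive relation is symmetric, then every reflexive relation is transitive. -/
theorem isMaltsevCategory_of_symm
    (hsymm : ∀ (X : C) (R : Relation X X), IsReflexive R →
      ∀ (A : C) (x y : A ⟶ X), Holds R x y → Holds R y x) :
    IsMaltsevCategory C := by
  intro X E hE
  have hrefl := isReflexive_iff.1 hE
  refine isEquivalence_of_holds hrefl (hsymm X E hE) fun A a b c hab hbc => ?_
  -- On the object `E`, relate two pairs when (first entry of one, second entry of the other) lies
  -- in `E`. Then `(b, c)` is related to `(a, b)` because `(b, b) ∈ E`; symmetry gives `(a, c) ∈ E`.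
  have hW : IsReflexive (inverseImage (leg₁ E) (leg₂ E) E) :=
    isReflexive_iff.2 fun B x => holds_inverseImage.2 (holds_comp_legs E x)
  obtain ⟨f, hf₁, hf₂⟩ := holds_iff_exists.1 hab
  obtain ⟨g, hg₁, hg₂⟩ := holds_iff_exists.1 hbc
  have h := hsymm _ _ hW A g f
    (holds_inverseImage.2 (by rw [hg₁, hf₂]; exact hrefl A b))
  rwa [holds_inverseImage, hf₁, hg₂] at h

theorem isMaltsevCategory_of_shiftingLemma (h : ShiftingLemmaForReflexive C) :
    IsMaltsevCategory C := by
  refine isMaltsevCategory_of_symm fun X E hE A a b hab => ?_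
  have hrefl := isReflexive_iff.1 hE
  have hop : IsReflexive (opposite E) :=
    isReflexive_iff.2 fun B x => holds_opposite.2 (hrefl B x)
  -- A degenerate parallelogram: `x = y = v = a` and `u = b`, where `(b, a) ∈ E°` is the hypothesis
  -- `hab`.
  exact h X (opposite E) E E hop hE hE inf_le_right A a a b a
    (holds_inf.2 ⟨holds_opposite.2 (hrefl A a), hrefl A a⟩) hab (hrefl A a)
    (holds_opposite.2 hab)

/-- This lets a relation be checked on a cover. -/
theorem Holds.of_strongEpi {X Y : C} {R : Relation X Y} {A B : C} (q : B ⟶ A) [StrongEpi q]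
    {x : A ⟶ X} {y : A ⟶ Y} (h : Holds R (q ≫ x) (q ≫ y)) : Holds R x y :=
  factors_of_strongEpi q (by simpa only [Holds, ← prod.comp_lift] using h)

end FiniteLimits

section Regular

variable {C : Type u} [Category.{v} C] [Regular C]

theorem factors_mk_strongEpiMonoFactorisation_comp {P A Y : C} (f : P ⟶ Y) (p : A ⟶ P) :
    (Subobject.mk (Regular.strongEpiMonoFactorisation f).m).Factors (p ≫ f) :=
  (Subobject.mk_factors_iff _ _).2 ⟨p ≫ (Regular.strongEpiMonoFactorisation f).e,
    (Category.assoc ..).trans (congrArg (p ≫ ·) (Regular.strongEpiMonoFactorisation f).fac)⟩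

/-- A morphism into the image of `f` lifts through `f` after passing to a cover. -/
theorem exists_cover_of_factors_mk_strongEpiMonoFactorisation {P A Y : C} {f : P ⟶ Y} {g : A ⟶ Y}
    (h : (Subobject.mk (Regular.strongEpiMonoFactorisation f).m).Factors g) :
    ∃ (B : C) (q : B ⟶ A) (p : B ⟶ P), StrongEpi q ∧ q ≫ g = p ≫ f := by
  obtain ⟨k, hk⟩ : ∃ k : A ⟶ (Regular.strongEpiMonoFactorisation f).I,
      k ≫ (Regular.strongEpiMonoFactorisation f).m = g := (Subobject.mk_factors_iff _ _).1 h
  -- The cover is the pullback along `k` of the epi part of `f`; covers are pullback-stable.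
  refine ⟨_, pullback.fst k (Regular.strongEpiMonoFactorisation f).e,
    pullback.snd k (Regular.strongEpiMonoFactorisation f).e, inferInstance, ?_⟩
  rw [← hk, ← Category.assoc, pullback.condition, Category.assoc, MonoFactorisation.fac]

/-- The composite `{(x, z) | ∃ y, (x, y) ∈ R ∧ (y, z) ∈ S}` of two relations. -/
noncomputable def composite {X Y Z : C} (R : Relation X Y) (S : Relation Y Z) : Relation X Z :=
  Subobject.mk (Regular.strongEpiMonoFactorisation
    (prod.lift (pullback.fst (leg₂ R) (leg₁ S) ≫ leg₁ R)
      (pullback.snd (leg₂ R) (leg₁ S) ≫ leg₂ S))).m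

theorem Holds.composite {X Y Z : C} {R : Relation X Y} {S : Relation Y Z} {A : C} {x : A ⟶ X}
    {y : A ⟶ Y} {z : A ⟶ Z} (hR : Holds R x y) (hS : Holds S y z) :
    Holds (composite R S) x z := by
  obtain ⟨f, rfl, hf⟩ := holds_iff_exists.1 hR
  obtain ⟨g, hg, rfl⟩ := holds_iff_exists.1 hS
  have h := factors_mk_strongEpiMonoFactorisation_comp
    (prod.lift (pullback.fst (leg₂ R) (leg₁ S) ≫ leg₁ R) (pullback.snd (leg₂ R) (leg₁ S) ≫ leg₂ S))
    (pullback.lift f g (hf.trans hg.symm))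
  rwa [prod.comp_lift, pullback.lift_fst_assoc, pullback.lift_snd_assoc] at h

/-- Elements related by a composite are, after passing to a cover, related via a middle element. -/
theorem exists_cover_of_holds_composite {X Y Z : C} {R : Relation X Y} {S : Relation Y Z} {A : C}
    {x : A ⟶ X} {z : A ⟶ Z} (h : Holds (composite R S) x z) :
    ∃ (B : C) (q : B ⟶ A) (y : B ⟶ Y), StrongEpi q ∧ Holds R (q ≫ x) y ∧ Holds S y (q ≫ z) := by
  obtain ⟨B, q, p, hq, e⟩ := exists_cover_of_factors_mk_strongEpiMonoFactorisation h
  have e₁ := congrArg (· ≫ prod.fst) e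
  have e₂ := congrArg (· ≫ prod.snd) e
  simp only [Category.assoc, prod.lift_fst, prod.lift_snd] at e₁ e₂
  refine ⟨B, q, p ≫ pullback.fst (leg₂ R) (leg₁ S) ≫ leg₂ R, hq, ?_, ?_⟩
  · rw [e₁]
    simpa only [Category.assoc] using holds_comp_legs R (p ≫ pullback.fst (leg₂ R) (leg₁ S))
  · rw [e₂, pullback.condition]
    simpa only [Category.assoc] using holds_comp_legs S (p ≫ pullback.snd (leg₂ R) (leg₁ S))

theorem shiftingLemma_of_isMaltsevCategory (hC : IsMaltsevCategory C) :
    ShiftingLemmaForReflexive C := by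
  intro X R S T hR hS hT hRST A x y u v hxy hxu hyv huv
  have eR := hC X R hR
  have eS := hC X S hS
  have eT := hC X T hT
  rw [isReflexive_iff] at hR hS hT
  have eST : IsEquivalence (composite S (R ⊓ T)) :=
    hC X _ (isReflexive_iff.2 fun B w =>
      (hS B w).composite (holds_inf.2 ⟨hR B w, hT B w⟩))
  -- From `u S x (R ⊓ T) y`, symmetry of the composite gives `y S w (R ⊓ T) u` on a cover.
  obtain ⟨B, q, w, hq, hyw, hwu⟩ :=
    exists_cover_of_holds_composite (eST.symm ((eS.symm hxu).composite hxy))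
  obtain ⟨hwuR, hwuT⟩ := holds_inf.1 hwu
  -- `w R u R v` and `w S y S v`, so `(w, v) ∈ R ⊓ S ≤ T`.
  have hwv : Holds T w (q ≫ v) := Holds.mono hRST
    (holds_inf.2 ⟨eR.trans hwuR (huv.precomp q), eS.trans (eS.symm hyw) (hyv.precomp q)⟩)
  exact Holds.of_strongEpi q (eT.trans (eT.symm hwuT) hwv)

end Regular

end RegularRelations

theorem theorem2p2 (C : Type u) [CategoryTheory.Category.{v} C] [CategoryTheory.Regular C] :
    RegularRelations.IsMaltsevCategory C ↔ RegularRelations.ShiftingLemmaForReflexive C :=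
  ⟨RegularRelations.shiftingLemma_of_isMaltsevCategory,
    RegularRelations.isMaltsevCategory_of_shiftingLemma⟩
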